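/- Let $H$ be a nonzero finite-dimensional complex Hilbert space, $d=\dim H$. A density operator on $H$ is a positive operator of trace one. A channel is a completely positive trace-preserving linear map $T:\mathcal B(H)\to\mathcal B(H)$. It is called strictly contractive if there is a constant $k\in[0,1)$ such that $\|T(\rho)-T(\sigma)\|_1\le k\,\|\rho-\sigma\|_1$ for all density operators $\rho,\sigma$ on $H$, where $\|A\|_1=\operatorname{tr}\sqrt{A^*A}$ is the trace norm. For an orthonormal basis $(e_i)$ of $H$ let $\Omega=\sum_i e_i\otimes e_i\in H\otimes H$ and $\rho_T=\frac1d\,(T\otimes\mathrm{id})(|\Omega\rangle\langle\Omega|)$; the channel fidelity of two channels $S,T$ is $$\mathcal F(S,T)=F(\rho_S,\rho_T),\qquad F(\rho_1,\rho_2)=\Bigl(\operatorname{tr}\sqrt{\sqrt{\rho_1}\,\rho_2\sqrt{\rho_1}}\Bigr)^2 .$$ For any channel $T$ on $H$ and any $\varepsilon>0$ there exists a strictly contractive channel $T'$ on $H$ such that $\mathcal F(T,T')>1-\varepsilon$, whichever orthonormal basis is used to compute $\mathcal F$. -/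

import Mathlib

open scoped TensorProduct CStarAlgebra InnerProductSpace

noncomputable section

namespace QInfo

/-- The Hilbert space tensor product of finite-dimensional Hilbert spaces is complete. -/
instance instCompleteSpaceTensor (H K : Type*)
    [NormedAddCommGroup H] [InnerProductSpace ℂ H] [FiniteDimensional ℂ H]
    [NormedAddCommGroup K] [InnerProductSpace ℂ K] [FiniteDimensional ℂ K] :
    CompleteSpace (H ⊗[ℂ] K) :=
  FiniteDimensional.complete ℂ (H ⊗[ℂ] K)

/-- The trace of an operator on a finite-dimensional Hilbert space. -/
def tr {H : Type*} [NormedAddCommGroup H] [InnerProductSpace ℂ H] (A : H →L[ℂ] H) : ℂ :=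
  LinearMap.trace ℂ H (A : H →ₗ[ℂ] H)

/-- The trace norm `tr |A| = tr (A* A)^{1/2}` (the trace is a nonnegative real number). -/
def traceNorm {H : Type*} [NormedAddCommGroup H] [InnerProductSpace ℂ H] [CompleteSpace H]
    (A : H →L[ℂ] H) : ℝ :=
  (tr (CFC.sqrt (star A * A))).re

/-- The set `𝓢(H)` of density operators: positive operators (in the Loewner order) of trace one. -/
def densityOperators (H : Type*) [NormedAddCommGroup H] [InnerProductSpace ℂ H] [CompleteSpace H] :
    Set (H →L[ℂ] H) :=
  {ρ | 0 ≤ ρ ∧ tr ρ = 1}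

/-- A quantum channel on `H` in the Schrödinger picture: a completely positive trace-preserving
linear map of `𝓑(H)` into itself. -/
structure Channel (H : Type*) [NormedAddCommGroup H] [InnerProductSpace ℂ H] [CompleteSpace H]
    extends (H →L[ℂ] H) →CP (H →L[ℂ] H) where
  tr_map' (A : H →L[ℂ] H) : tr (toFun A) = tr A

/-- The underlying linear map of a channel. -/
def Channel.map {H : Type*} [NormedAddCommGroup H] [InnerProductSpace ℂ H] [CompleteSpace H]
    (T : Channel H) : (H →L[ℂ] H) →ₗ[ℂ] (H →L[ℂ] H) :=
  T.toCompletelyPositiveMap.toLinearMap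

/-- A channel is strictly contractive if it contracts the trace-norm distance of density operators
by a factor `k ∈ [0, 1)`. -/
def Channel.IsStrictlyContractive {H : Type*} [NormedAddCommGroup H] [InnerProductSpace ℂ H]
    [CompleteSpace H] (T : Channel H) : Prop :=
  ∃ k : ℝ, 0 ≤ k ∧ k < 1 ∧ ∀ ρ ∈ densityOperators H, ∀ σ ∈ densityOperators H,
    traceNorm (T.map ρ - T.map σ) ≤ k * traceNorm (ρ - σ)

/-- The Jozsa–Uhlmann fidelity `F(ρ₁, ρ₂) = (tr √(√ρ₁ ρ₂ √ρ₁))²` of density operators. -/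
def fidelity {H : Type*} [NormedAddCommGroup H] [InnerProductSpace ℂ H] [CompleteSpace H]
    (ρ₁ ρ₂ : H →L[ℂ] H) : ℝ :=
  (tr (CFC.sqrt (CFC.sqrt ρ₁ * ρ₂ * CFC.sqrt ρ₁))).re ^ 2

section Choi

variable {H K : Type*}
  [NormedAddCommGroup H] [InnerProductSpace ℂ H] [FiniteDimensional ℂ H]
  [NormedAddCommGroup K] [InnerProductSpace ℂ K] [FiniteDimensional ℂ K]

/-- The operator `A ⊗ B` on `H ⊗ K`. -/
def opTensor (A : H →L[ℂ] H) (B : K →L[ℂ] K) : (H ⊗[ℂ] K) →L[ℂ] (H ⊗[ℂ] K) :=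
  LinearMap.toContinuousLinearMap
    (TensorProduct.map (A : H →ₗ[ℂ] H) (B : K →ₗ[ℂ] K))

/-- The identification `𝓑(H) ⊗ 𝓑(K) ≃ 𝓑(H ⊗ K)`, sending `A ⊗ B` to `opTensor A B`. -/
def opTensorEquiv (H K : Type*)
    [NormedAddCommGroup H] [InnerProductSpace ℂ H] [FiniteDimensional ℂ H]
    [NormedAddCommGroup K] [InnerProductSpace ℂ K] [FiniteDimensional ℂ K] :
    ((H →L[ℂ] H) ⊗[ℂ] (K →L[ℂ] K)) ≃ₗ[ℂ] ((H ⊗[ℂ] K) →L[ℂ] (H ⊗[ℂ] K)) :=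
  (TensorProduct.congr LinearMap.toContinuousLinearMap.symm
    LinearMap.toContinuousLinearMap.symm).trans
    ((homTensorHomEquiv ℂ H K H K).trans LinearMap.toContinuousLinearMap)

theorem opTensorEquiv_tmul (A : H →L[ℂ] H) (B : K →L[ℂ] K) :
    opTensorEquiv H K (A ⊗ₜ[ℂ] B) = opTensor A B := by
  simp [opTensorEquiv, opTensor]

/-- The map `T ⊗ id` on `𝓑(H ⊗ K)`, for a linear map `T` on `𝓑(H)`. -/
def tensorId (K : Type*) [NormedAddCommGroup K] [InnerProductSpace ℂ K] [FiniteDimensional ℂ K]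
    (T : (H →L[ℂ] H) →ₗ[ℂ] (H →L[ℂ] H)) :
    ((H ⊗[ℂ] K) →L[ℂ] (H ⊗[ℂ] K)) →ₗ[ℂ] ((H ⊗[ℂ] K) →L[ℂ] (H ⊗[ℂ] K)) :=
  (opTensorEquiv H K).toLinearMap ∘ₗ
    TensorProduct.map T LinearMap.id ∘ₗ (opTensorEquiv H K).symm.toLinearMap

theorem tensorId_opTensor (T : (H →L[ℂ] H) →ₗ[ℂ] (H →L[ℂ] H)) (A : H →L[ℂ] H) (B : K →L[ℂ] K) :
    tensorId K T (opTensor A B) = opTensor (T A) B := by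
  rw [← opTensorEquiv_tmul, ← opTensorEquiv_tmul]
  simp [tensorId]

/-- The unnormalized maximally entangled vector `∑ᵢ eᵢ ⊗ eᵢ` for an orthonormal basis `(eᵢ)`. -/
def maxEntangled {ι : Type*} [Fintype ι] (e : OrthonormalBasis ι ℂ H) : H ⊗[ℂ] H :=
  ∑ i, e i ⊗ₜ[ℂ] e i

/-- The normalized Choi operator `ρ_T = (1/d) (T ⊗ id)(|Ω⟩⟨Ω|)`, where `Ω = ∑ᵢ eᵢ ⊗ eᵢ` and
`d = dim H`. -/
def choiState [CompleteSpace H] {ι : Type*} [Fintype ι] (e : OrthonormalBasis ι ℂ H)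
    (T : Channel H) : (H ⊗[ℂ] H) →L[ℂ] (H ⊗[ℂ] H) :=
  ((Module.finrank ℂ H : ℂ)⁻¹) •
    tensorId H T.map (InnerProductSpace.rankOne ℂ (maxEntangled e) (maxEntangled e))

/-- The channel fidelity: the Jozsa–Uhlmann fidelity of the normalized Choi operators. -/
def channelFidelity [CompleteSpace H] {ι : Type*} [Fintype ι] (e : OrthonormalBasis ι ℂ H)
    (S T : Channel H) : ℝ :=
  fidelity (choiState e S) (choiState e T)

end Choi

end QInfo

end

/-!
The approximating channel is `T' = (1 - δ) T + δ R`, where `R` is the channel `A ↦ tr A • |v⟩⟨v|`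
that replaces every state by a fixed pure state, and `δ = min (ε / 2) 1`.

* *Strict contractivity.* On a difference of two density operators the term `δ R` vanishes, so
  `T' ρ - T' σ = (1 - δ) (T ρ - T σ)`. It remains to know that a positive trace-preserving map does
  not increase the trace norm of a self-adjoint operator `A` (`Channel.traceNorm_map_le`). This
  follows from the decomposition `A = A⁺ - A⁻` and the bound `‖P - Q‖₁ ≤ tr P + tr Q` for positive
  `P`, `Q` (`traceNorm_sub_le`), obtained by computing the traces in an eigenbasis of `P - Q`.

* *Fidelity.* The Choi operator is affine in the channel, so
  `ρ_{T'} = (1 - δ) ρ_T + δ ρ_R ≥ (1 - δ) ρ_T`, and therefore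
  `√ρ_T ρ_{T'} √ρ_T ≥ (1 - δ) ρ_T²`. Operator monotonicity of the square root gives
  `F(ρ_T, ρ_{T'}) ≥ (√(1 - δ) tr ρ_T)² = 1 - δ` (`le_fidelity_convexComb`).

The second part uses that Choi operators are density operators. Positivity
(`choiState_nonneg`) comes from complete positivity: the operator matrix `(|eᵢ⟩⟨eⱼ|)ᵢⱼ` is positive,
hence so is `(T |eᵢ⟩⟨eⱼ|)ᵢⱼ = N* N`, and `∑ᵢⱼ (N* N)ᵢⱼ ⊗ |eᵢ⟩⟨eⱼ|` is a sum of terms `W* W`.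
-/

namespace QInfo

noncomputable section

open InnerProductSpace

/-! ### Trace and trace norm -/

section Trace

variable {H : Type*} [NormedAddCommGroup H] [InnerProductSpace ℂ H]

theorem tr_eq_sum_inner {ι : Type*} [Fintype ι] (b : OrthonormalBasis ι ℂ H) (A : H →L[ℂ] H) :
    tr A = ∑ i, inner ℂ (b i) (A (b i)) :=
  LinearMap.trace_eq_sum_inner _ b

theorem tr_add (A B : H →L[ℂ] H) : tr (A + B) = tr A + tr B := by simp [tr]

theorem tr_sub (A B : H →L[ℂ] H) : tr (A - B) = tr A - tr B := by simp [tr]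

theorem tr_smul (c : ℂ) (A : H →L[ℂ] H) : tr (c • A) = c * tr A := by simp [tr]

theorem tr_sum {ι : Type*} (s : Finset ι) (A : ι → H →L[ℂ] H) :
    tr (∑ i ∈ s, A i) = ∑ i ∈ s, tr (A i) := by
  simp [tr]

theorem tr_rankOne [FiniteDimensional ℂ H] (x y : H) : tr (rankOne ℂ x y) = inner ℂ y x :=
  trace_rankOne x y

theorem re_inner_apply_nonneg {A : H →L[ℂ] H} (hA : 0 ≤ A) (x : H) :
    0 ≤ (inner ℂ x (A x)).re :=
  ((ContinuousLinearMap.nonneg_iff_isPositive A).1 hA).re_inner_nonneg_right x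

theorem re_tr_mono [FiniteDimensional ℂ H] {A B : H →L[ℂ] H} (h : A ≤ B) :
    (tr A).re ≤ (tr B).re := by
  have := FiniteDimensional.complete ℂ H
  rw [← sub_nonneg, ← Complex.sub_re, ← tr_sub, tr_eq_sum_inner (stdOrthonormalBasis ℂ H),
    Complex.re_sum]
  exact Finset.sum_nonneg fun i _ => re_inner_apply_nonneg (sub_nonneg.2 h) _

variable [CompleteSpace H]

theorem ofReal_smul_nonneg {c : ℝ} (hc : 0 ≤ c) {A : H →L[ℂ] H} (hA : 0 ≤ A) :
    0 ≤ (c : ℂ) • A := by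
  rw [Complex.coe_smul]
  exact smul_nonneg hc hA

theorem norm_abs_apply (A : H →L[ℂ] H) (x : H) : ‖CFC.abs A x‖ = ‖A x‖ := by
  have h : ∀ B : H →L[ℂ] H, ‖B x‖ ^ 2 = (inner ℂ x ((star B * B) x)).re := fun B => by
    rw [ContinuousLinearMap.star_eq_adjoint, mul_apply_eq_comp,
      ContinuousLinearMap.adjoint_inner_right]
    exact (inner_self_eq_norm_sq (𝕜 := ℂ) (B x)).symm
  have hs : star (CFC.abs A) = CFC.abs A := (CFC.abs_nonneg A).isSelfAdjoint
  rw [← sq_eq_sq₀ (norm_nonneg _) (norm_nonneg _), h, h, hs, CFC.abs_mul_abs]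

/-- For an orthonormal eigenbasis `(bᵢ)` of `P - Q` with eigenvalues `λᵢ`, Cauchy–Schwarz gives
`⟪bᵢ, |P - Q| bᵢ⟫ ≤ ‖(P - Q) bᵢ‖ = |λᵢ|`, while `λᵢ = ⟪bᵢ, P bᵢ⟫ - ⟪bᵢ, Q bᵢ⟫`. -/
theorem traceNorm_sub_le [FiniteDimensional ℂ H] {P Q : H →L[ℂ] H} (hP : 0 ≤ P) (hQ : 0 ≤ Q) :
    traceNorm (P - Q) ≤ (tr P).re + (tr Q).re := by
  have hY : ((P - Q : H →L[ℂ] H) : H →ₗ[ℂ] H).IsSymmetric :=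
    (hP.isSelfAdjoint.sub hQ.isSelfAdjoint).isSymmetric
  let b := hY.eigenvectorBasis rfl
  change (tr (CFC.abs (P - Q))).re ≤ _
  simp only [tr_eq_sum_inner b, Complex.re_sum, ← Finset.sum_add_distrib]
  refine Finset.sum_le_sum fun i _ => ?_
  have h1 : (P - Q) (b i) = (hY.eigenvalues rfl i : ℂ) • b i := hY.apply_eigenvectorBasis rfl i
  have hb : ‖b i‖ = 1 := b.orthonormal.1 i
  have h2 : (inner ℂ (b i) (P (b i))).re - (inner ℂ (b i) (Q (b i))).re =
      hY.eigenvalues rfl i := by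
    rw [← Complex.sub_re, ← inner_sub_right, ← sub_apply, h1, inner_smul_right,
      inner_self_eq_norm_sq_to_K, hb]
    simp
  have hP' := re_inner_apply_nonneg hP (b i)
  have hQ' := re_inner_apply_nonneg hQ (b i)
  calc (inner ℂ (b i) (CFC.abs (P - Q) (b i))).re
      ≤ ‖inner ℂ (b i) (CFC.abs (P - Q) (b i))‖ := Complex.re_le_norm _
    _ ≤ ‖b i‖ * ‖CFC.abs (P - Q) (b i)‖ := norm_inner_le_norm _ _
    _ = |hY.eigenvalues rfl i| := by rw [norm_abs_apply, h1, norm_smul, hb]; simp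
    _ ≤ _ := by rw [← h2, abs_le]; constructor <;> linarith

theorem traceNorm_ofReal_smul {c : ℝ} (hc : 0 ≤ c) (A : H →L[ℂ] H) :
    traceNorm ((c : ℂ) • A) = c * traceNorm A := by
  change (tr (CFC.abs _)).re = c * (tr (CFC.abs A)).re
  rw [CFC.abs_smul, Complex.norm_real, Real.norm_of_nonneg hc, ← Complex.coe_smul, tr_smul,
    Complex.re_ofReal_mul]

theorem Channel.map_nonneg (T : Channel H) {A : H →L[ℂ] H} (hA : 0 ≤ A) : 0 ≤ T.map A :=
  _root_.map_nonneg T.toCompletelyPositiveMap hA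

theorem Channel.tr_map (T : Channel H) (A : H →L[ℂ] H) : tr (T.map A) = tr A := T.tr_map' A

/-- Write `A = A⁺ - A⁻`; then `‖T A‖₁ ≤ tr (T A⁺) + tr (T A⁻) = tr |A|`. -/
theorem Channel.traceNorm_map_le [FiniteDimensional ℂ H] (T : Channel H) {A : H →L[ℂ] H}
    (hA : IsSelfAdjoint A) : traceNorm (T.map A) ≤ traceNorm A := by
  have h := traceNorm_sub_le (T.map_nonneg (CFC.posPart_nonneg A))
    (T.map_nonneg (CFC.negPart_nonneg A))
  rw [← map_sub, CFC.posPart_sub_negPart A hA, T.tr_map, T.tr_map, ← Complex.add_re, ← tr_add,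
    CFC.posPart_add_negPart A hA] at h
  exact h

/-- The sandwiched operator `√ρ ((1 - δ) ρ + δ σ) √ρ` dominates `(1 - δ) ρ²`, whose square root is
`√(1 - δ) ρ`; the bound follows by operator monotonicity of the square root. -/
theorem le_fidelity_convexComb [FiniteDimensional ℂ H] {ρ σ : H →L[ℂ] H}
    (hρ : ρ ∈ densityOperators H) (hσ : 0 ≤ σ) {δ : ℝ} (h0 : 0 ≤ δ) (h1 : δ ≤ 1) :
    1 - δ ≤ fidelity ρ (((1 - δ : ℝ) : ℂ) • ρ + (δ : ℂ) • σ) := by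
  have hδ := sub_nonneg.2 h1
  set R := CFC.sqrt ρ
  have hR0 : 0 ≤ R := CFC.sqrt_nonneg ρ
  have hRR : R * R = ρ := CFC.sqrt_mul_sqrt_self ρ hρ.1
  have hle : ((1 - δ : ℝ) : ℂ) • (ρ * ρ) ≤ R * (((1 - δ : ℝ) : ℂ) • ρ + (δ : ℂ) • σ) * R := by
    have h : R * (((1 - δ : ℝ) : ℂ) • ρ + (δ : ℂ) • σ) * R =
        ((1 - δ : ℝ) : ℂ) • (ρ * ρ) + (δ : ℂ) • (R * σ * R) := by
      rw [← hRR]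
      simp only [mul_add, add_mul, mul_smul_comm, smul_mul_assoc, mul_assoc]
    rw [h]
    refine le_add_of_nonneg_right (ofReal_smul_nonneg h0 ?_)
    have := star_left_conjugate_nonneg hσ R
    rwa [hR0.isSelfAdjoint.star_eq] at this
  have hsq : CFC.sqrt (((1 - δ : ℝ) : ℂ) • (ρ * ρ)) = ((√(1 - δ) : ℝ) : ℂ) • ρ := by
    refine CFC.sqrt_unique ?_ (ofReal_smul_nonneg (Real.sqrt_nonneg _) hρ.1)
    rw [smul_mul_smul_comm, ← Complex.ofReal_mul, Real.mul_self_sqrt hδ]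
  have h := re_tr_mono (CFC.sqrt_le_sqrt _ _ hle)
  rw [hsq, tr_smul, hρ.2, mul_one, Complex.ofReal_re] at h
  calc 1 - δ = √(1 - δ) ^ 2 := (Real.sq_sqrt hδ).symm
    _ ≤ _ := pow_le_pow_left₀ (Real.sqrt_nonneg _) h 2

end Trace

/-! ### Positivity of matrices over a C⋆-algebra -/

section CStarMatrix

variable {A : Type*} [CStarAlgebra A] [PartialOrder A] [StarOrderedRing A] {n : Type*} [Fintype n]

theorem cstarMatrix_map_conj_nonneg (K : A) {M : CStarMatrix n n A} (hM : 0 ≤ M) :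
    0 ≤ M.map (fun a => K * a * star K) := by
  classical
  let C : CStarMatrix n n A := CStarMatrix.ofMatrix (Matrix.diagonal fun _ => star K)
  have h := star_left_conjugate_nonneg hM C
  convert h using 1
  ext i j
  simp [C, CStarMatrix.mul_apply, CStarMatrix.star_apply, Matrix.diagonal_apply, apply_ite star]

theorem cstarMatrix_ofReal_smul_nonneg {c : ℝ} (hc : 0 ≤ c) {M : CStarMatrix n n A}
    (hM : 0 ≤ M) : 0 ≤ (c : ℂ) • M := by
  have h := cstarMatrix_map_conj_nonneg (((√c : ℝ) : ℂ) • (1 : A)) hM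
  have hc' : ((√c : ℝ) : ℂ) * ((√c : ℝ) : ℂ) = c := by
    rw [← Complex.ofReal_mul, Real.mul_self_sqrt hc]
  convert h using 1
  ext i j
  change (c : ℂ) • M i j = (((√c : ℝ) : ℂ) • (1 : A)) * M i j * star (((√c : ℝ) : ℂ) • (1 : A))
  rw [star_smul, star_one, smul_mul_assoc, one_mul, mul_smul_comm, mul_one, smul_smul,
    RCLike.star_def, Complex.conj_ofReal, hc']

/-- For `CStarMatrix` the instances required by `CStarAlgebra.nonneg_iff_eq_star_mul_self` are
found only through an abstract C⋆-algebra. -/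
theorem exists_eq_star_mul_self {a : A} (ha : 0 ≤ a) : ∃ b, a = star b * b :=
  CStarAlgebra.nonneg_iff_eq_star_mul_self.1 ha

theorem star_sum_mul_sum {R : Type*} [NonUnitalSemiring R] [StarRing R] {ι : Type*} (s : Finset ι)
    (f : ι → R) : star (∑ i ∈ s, f i) * ∑ j ∈ s, f j = ∑ i ∈ s, ∑ j ∈ s, star (f i) * f j := by
  rw [star_sum, Finset.sum_mul_sum]

end CStarMatrix

/-! ### Mixing a channel with a reset channel -/

section Channel

variable {H : Type*} [NormedAddCommGroup H] [InnerProductSpace ℂ H] [CompleteSpace H]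

/-- The convex combination `(1 - δ) T + δ S` of two channels. -/
def Channel.mix (δ : ℝ) (h0 : 0 ≤ δ) (h1 : δ ≤ 1) (T S : Channel H) : Channel H where
  toLinearMap := ((1 - δ : ℝ) : ℂ) • T.map + (δ : ℂ) • S.map
  map_cstarMatrix_nonneg' k M hM := by
    have hT := cstarMatrix_ofReal_smul_nonneg (sub_nonneg.2 h1) (T.map_cstarMatrix_nonneg' k M hM)
    have hS := cstarMatrix_ofReal_smul_nonneg h0 (S.map_cstarMatrix_nonneg' k M hM)
    exact add_nonneg hT hS
  tr_map' A := by
    change tr (((1 - δ : ℝ) : ℂ) • T.map A + (δ : ℂ) • S.map A) = tr A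
    rw [tr_add, tr_smul, tr_smul, T.tr_map, S.tr_map, ← add_mul]
    simp

theorem Channel.mix_map (δ : ℝ) (h0 : 0 ≤ δ) (h1 : δ ≤ 1) (T S : Channel H) :
    (Channel.mix δ h0 h1 T S).map = ((1 - δ : ℝ) : ℂ) • T.map + (δ : ℂ) • S.map := rfl

/-- A Kraus decomposition of `A ↦ tr A • |v⟩⟨v|`. -/
theorem tr_smul_rankOne_eq_sum (v : H) {ι : Type*} [Fintype ι] (b : OrthonormalBasis ι ℂ H)
    (A : H →L[ℂ] H) :
    tr A • rankOne ℂ v v = ∑ i, rankOne ℂ v (b i) * A * star (rankOne ℂ v (b i)) := by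
  ext x
  simp [ContinuousLinearMap.star_eq_adjoint, tr_eq_sum_inner b, Finset.sum_smul, smul_smul,
    mul_comm, sum_apply]

theorem star_rankOne_mul_rankOne {v : H} (hv : ‖v‖ = 1) (x y : H) :
    star (rankOne ℂ v x) * rankOne ℂ v y = rankOne ℂ x y := by
  rw [ContinuousLinearMap.star_eq_adjoint, adjoint_rankOne]
  ext z
  simp [hv]

variable [FiniteDimensional ℂ H]

/-- The channel `A ↦ tr A • |v⟩⟨v|`, which sends every state to the pure state of the unit
vector `v`. -/
def Channel.reset (v : H) (hv : ‖v‖ = 1) : Channel H where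
  toLinearMap :=
    { toFun := fun A => tr A • rankOne ℂ v v
      map_add' := fun A B => by rw [tr_add, add_smul]
      map_smul' := fun c A => by rw [tr_smul, mul_smul, RingHom.id_apply] }
  map_cstarMatrix_nonneg' k M hM := by
    have h := Finset.sum_nonneg fun i (_ : i ∈ Finset.univ) => cstarMatrix_map_conj_nonneg
      (rankOne ℂ v (stdOrthonormalBasis ℂ H i)) hM
    convert h using 1
    ext i j : 1
    have hs : ∀ (s : Finset (Fin (Module.finrank ℂ H)))
        (f : Fin (Module.finrank ℂ H) → CStarMatrix (Fin k) (Fin k) (H →L[ℂ] H)),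
        (∑ l ∈ s, f l) i j = ∑ l ∈ s, f l i j := fun s f => Matrix.sum_apply i j s f
    rw [hs]
    exact tr_smul_rankOne_eq_sum v (stdOrthonormalBasis ℂ H) (M i j)
  tr_map' A := by
    change tr (tr A • rankOne ℂ v v) = tr A
    rw [tr_smul, tr_rankOne, inner_self_eq_norm_sq_to_K, hv]
    simp

theorem Channel.reset_map (v : H) (hv : ‖v‖ = 1) (A : H →L[ℂ] H) :
    (Channel.reset v hv).map A = tr A • rankOne ℂ v v := rfl

theorem Channel.mix_reset_isStrictlyContractive (T : Channel H) (v : H) (hv : ‖v‖ = 1) {δ : ℝ}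
    (h0 : 0 < δ) (h1 : δ ≤ 1) :
    (Channel.mix δ h0.le h1 T (.reset v hv)).IsStrictlyContractive := by
  refine ⟨1 - δ, sub_nonneg.2 h1, by linarith, fun ρ hρ σ hσ => ?_⟩
  rw [← map_sub, Channel.mix_map, LinearMap.add_apply, LinearMap.smul_apply, LinearMap.smul_apply,
    Channel.reset_map, tr_sub, hρ.2, hσ.2, sub_self, zero_smul, smul_zero, add_zero,
    traceNorm_ofReal_smul (sub_nonneg.2 h1)]
  exact mul_le_mul_of_nonneg_left
    (T.traceNorm_map_le (hρ.1.isSelfAdjoint.sub hσ.1.isSelfAdjoint)) (sub_nonneg.2 h1)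

end Channel

/-! ### Choi operators -/

section OpTensor

variable {H K : Type*}
  [NormedAddCommGroup H] [InnerProductSpace ℂ H] [FiniteDimensional ℂ H]
  [NormedAddCommGroup K] [InnerProductSpace ℂ K] [FiniteDimensional ℂ K]

theorem opTensor_mul (A B : H →L[ℂ] H) (C D : K →L[ℂ] K) :
    opTensor A C * opTensor B D = opTensor (A * B) (C * D) := by
  refine ContinuousLinearMap.coe_injective (TensorProduct.ext' fun x y => ?_)
  simp [opTensor]

theorem star_opTensor [CompleteSpace H] [CompleteSpace K] (A : H →L[ℂ] H) (C : K →L[ℂ] K) :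
    star (opTensor A C) = opTensor (star A) (star C) := by
  refine ContinuousLinearMap.coe_injective ?_
  exact TensorProduct.adjoint_map (A : H →ₗ[ℂ] H) (C : K →ₗ[ℂ] K)

theorem opTensor_sum_left {ι : Type*} (s : Finset ι) (A : ι → H →L[ℂ] H) (B : K →L[ℂ] K) :
    opTensor (∑ i ∈ s, A i) B = ∑ i ∈ s, opTensor (A i) B := by
  refine ContinuousLinearMap.coe_injective (TensorProduct.ext' fun a b => ?_)
  simp [opTensor, TensorProduct.sum_tmul]

theorem tr_opTensor (A : H →L[ℂ] H) (B : K →L[ℂ] K) : tr (opTensor A B) = tr A * tr B :=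
  LinearMap.trace_tensorProduct' _ _

theorem rankOne_tmul (x y : H) (z w : K) :
    rankOne ℂ (x ⊗ₜ[ℂ] z) (y ⊗ₜ[ℂ] w) = opTensor (rankOne ℂ x y) (rankOne ℂ z w) := by
  refine ContinuousLinearMap.coe_injective (TensorProduct.ext' fun a b => ?_)
  simp [opTensor, TensorProduct.smul_tmul', smul_smul, mul_comm]

theorem tensorId_add_smul (a b : ℂ) (T S : (H →L[ℂ] H) →ₗ[ℂ] (H →L[ℂ] H)) :
    tensorId K (a • T + b • S) = a • tensorId K T + b • tensorId K S := by
  simp only [tensorId, TensorProduct.map_add_left, TensorProduct.map_smul_left,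
    LinearMap.add_comp, LinearMap.comp_add, LinearMap.smul_comp, LinearMap.comp_smul]

end OpTensor

section Choi

variable {H : Type*} [NormedAddCommGroup H] [InnerProductSpace ℂ H] [CompleteSpace H]
  [FiniteDimensional ℂ H] {ι : Type*} [Fintype ι] (e : OrthonormalBasis ι ℂ H)

theorem choiState_eq_sum (T : Channel H) :
    choiState e T = (Module.finrank ℂ H : ℂ)⁻¹ • ∑ i, ∑ j,
      opTensor (T.map (rankOne ℂ (e i) (e j))) (rankOne ℂ (e i) (e j)) := by
  simp only [choiState, maxEntangled, map_sum, sum_apply, rankOne_tmul, tensorId_opTensor]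
  rw [Finset.sum_comm]

/-- If `M = N* N`, then `∑ᵢⱼ Mᵢⱼ ⊗ |vᵢ⟩⟨vⱼ| = ∑ₖ Wₖ* Wₖ` with `Wₖ = ∑ⱼ Nₖⱼ ⊗ |u⟩⟨vⱼ|` for any
unit vector `u`. -/
theorem sum_opTensor_rankOne_nonneg [Nontrivial H] (v : ι → H)
    {M : CStarMatrix ι ι (H →L[ℂ] H)} (hM : 0 ≤ M) :
    0 ≤ ∑ i, ∑ j, opTensor (M i j) (rankOne ℂ (v i) (v j)) := by
  classical
  obtain ⟨u, hu⟩ := exists_norm_eq H zero_le_one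
  obtain ⟨N, rfl⟩ := exists_eq_star_mul_self hM
  let W : ι → (H ⊗[ℂ] H) →L[ℂ] (H ⊗[ℂ] H) := fun k =>
    ∑ j, opTensor (N k j) (rankOne ℂ u (v j))
  have hW : ∀ k, star (W k) * W k =
      ∑ i, ∑ j, opTensor (star (N k i) * N k j) (rankOne ℂ (v i) (v j)) := fun k => by
    refine (star_sum_mul_sum (R := (H ⊗[ℂ] H) →L[ℂ] (H ⊗[ℂ] H)) Finset.univ
      fun j => opTensor (N k j) (rankOne ℂ u (v j))).trans
      (Finset.sum_congr rfl fun i _ => Finset.sum_congr rfl fun j _ => ?_)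
    rw [star_opTensor, opTensor_mul, star_rankOne_mul_rankOne hu]
  have h : ∑ i, ∑ j, opTensor ((star N * N) i j) (rankOne ℂ (v i) (v j)) =
      ∑ k, star (W k) * W k := by
    simp only [hW, CStarMatrix.mul_apply, CStarMatrix.star_apply, opTensor_sum_left]
    exact (Finset.sum_congr rfl fun i _ => Finset.sum_comm).trans Finset.sum_comm
  rw [h]
  exact Finset.sum_nonneg fun k _ => star_mul_self_nonneg (W k)

omit [FiniteDimensional ℂ H] in
theorem cstarMatrix_rankOne_nonneg [Nontrivial H] :
    0 ≤ (CStarMatrix.ofMatrix (Matrix.of fun i j => rankOne ℂ (e i) (e j)) :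
      CStarMatrix ι ι (H →L[ℂ] H)) := by
  classical
  obtain ⟨o⟩ := e.toBasis.index_nonempty
  -- The matrix is `R* R`, where `R` has the single nonzero row `(|eₒ⟩⟨eⱼ|)ⱼ`.
  let R : CStarMatrix ι ι (H →L[ℂ] H) := CStarMatrix.ofMatrix <| Matrix.of fun k j =>
    if k = o then rankOne ℂ (e o) (e j) else 0
  have h := star_mul_self_nonneg R
  convert h using 1
  ext i j : 1
  rw [CStarMatrix.mul_apply, Finset.sum_eq_single o]
  · rw [CStarMatrix.star_apply]
    simp [R, star_rankOne_mul_rankOne (e.orthonormal.1 o)]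
  · intro k _ hk
    simp [R, hk]
  · simp

theorem choiState_nonneg [Nontrivial H] (T : Channel H) : 0 ≤ choiState e T := by
  rw [choiState_eq_sum]
  have h := sum_opTensor_rankOne_nonneg e (T.toCompletelyPositiveMap.map_cstarMatrix_nonneg _
    (cstarMatrix_rankOne_nonneg e))
  have hd : ((Module.finrank ℂ H : ℂ)⁻¹) = (((Module.finrank ℂ H : ℝ)⁻¹ : ℝ) : ℂ) := by simp
  rw [hd]
  exact ofReal_smul_nonneg (by positivity) h

theorem tr_choiState [Nontrivial H] (T : Channel H) : tr (choiState e T) = 1 := by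
  classical
  have hd : (Module.finrank ℂ H : ℂ) ≠ 0 := by exact_mod_cast Module.finrank_pos.ne'
  rw [choiState_eq_sum, tr_smul]
  simp only [tr_sum, tr_opTensor, T.tr_map, tr_rankOne]
  simp [orthonormal_iff_ite.1 e.orthonormal, Module.finrank_eq_card_basis e.toBasis] at hd ⊢
  simp [hd]

theorem choiState_mix (T S : Channel H) {δ : ℝ} (h0 : 0 ≤ δ) (h1 : δ ≤ 1) :
    choiState e (.mix δ h0 h1 T S) =
      ((1 - δ : ℝ) : ℂ) • choiState e T + (δ : ℂ) • choiState e S := by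
  have h {V : Type _} [AddCommGroup V] [Module ℂ V] (a b c : ℂ) (x y : V) :
      a • (b • x + c • y) = b • a • x + c • a • y := by
    rw [smul_add, smul_comm a b, smul_comm a c]
  simp only [choiState, Channel.mix_map, tensorId_add_smul, LinearMap.add_apply,
    LinearMap.smul_apply]
  exact h (V := (H ⊗[ℂ] H) →L[ℂ] (H ⊗[ℂ] H)) _ _ _ _ _

end Choi

end

end QInfo

theorem mainTheorem5 {H : Type*} [NormedAddCommGroup H] [InnerProductSpace ℂ H]
    [CompleteSpace H] [FiniteDimensional ℂ H] [Nontrivial H]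
    (T : QInfo.Channel H) (ε : ℝ) (hε : 0 < ε) :
    ∃ T' : QInfo.Channel H, T'.IsStrictlyContractive ∧
      ∀ e : OrthonormalBasis (Fin (Module.finrank ℂ H)) ℂ H,
        1 - ε < QInfo.channelFidelity e T T' := by
  obtain ⟨v, hv⟩ := exists_norm_eq H zero_le_one
  have h0 : 0 < min (ε / 2) 1 := by positivity
  refine ⟨.mix _ h0.le (min_le_right _ _) T (.reset v hv),
    T.mix_reset_isStrictlyContractive v hv h0 _, fun e => ?_⟩
  have h := QInfo.le_fidelity_convexComb
    ⟨QInfo.choiState_nonneg e T, QInfo.tr_choiState e T⟩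
    (QInfo.choiState_nonneg e (.reset v hv)) h0.le (min_le_right (ε / 2) 1)
  rw [← QInfo.choiState_mix e T (.reset v hv) h0.le (min_le_right _ _)] at h
  have := min_le_left (ε / 2) 1
  exact lt_of_lt_of_le (by linarith) h
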